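/- Let $S_0$ be a finite set of sites. A (relaxed) abstract bisector system on $S_0$ assigns to any two sites $p\neq q$ disjoint open sets $D(p,q)$ and $D(q,p)$ of the plane, the dominance regions of $p$ and $q$, whose complement $J(p,q)=J(q,p)=\mathbb{R}^2\setminus(D(p,q)\cup D(q,p))$, the bisector, is a nonempty topological curve (possibly disconnected, with closed or unbounded components) that locally has $D(p,q)$ on one side (label $p$) and $D(q,p)$ on the other (label $q$). For $S'\subseteq S_0$ put $\mathrm{VR}(p,S')=\bigcap_{q\in S'\setminus\{p\}}D(p,q)$ and $\mathcal V(S')=\mathbb{R}^2\setminus\bigcup_{p\in S'}\mathrm{VR}(p,S')$. The system satisfies: (A2) for every nonempty $S'\subseteq S_0$, every point of the plane lies in the closure of $\mathrm{VR}(p,S')$ for some $p\in S'$; (A4) any two different bisectors intersect transversally and in finitely many points. It is moreover in general position: no three bisectors involving one common site meet in a point. Let $D$ be a simply connected open domain in the plane and let $G$ be a finite plane graph on the arrangement of the bisectors, truncated within $D$: its vertices inside $D$ are vertices of the arrangement, its edges are maximal arcs of bisectors inside $D$ between vertices, and its leaves are points of $\partial D$. Suppose that $G$ is Voronoi-like: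 for every vertex $v$ of $G$ inside $D$ there are three sites whose bisectors pass through $v$ and whose Voronoi diagram coincides with $G$ near $v$; and, if $G$ is disconnected, the arcs of $G$ bounding any one face have consistent labels inside that face. Let $S$ be the set of sites involved in the edges of $G$. A face of $G$ is a connected component of $D\setminus G$; its site is the one site $p$ such that the bisectors bounding the face have the label $p$ inside it. A face of $\mathcal V(S)\cap D$ of site $p$ is a connected component of $\mathrm{VR}(p,S)\cap D$; it is missing from $G$ if it is covered by (closures of) faces of $G$ whose site is not $p$. Then for every face $r$ of $G$, with site $s_r$, one of the following holds. 1. There is a face $r'$ of $\mathcal V(S)\cap D$ of the same site $s_r$, $r'\subseteq \mathrm{VR}(s_r,S)$, such that $r'\subseteq r$. 2. The face $r$ is disjoint from $\mathrm{VR}(s_r,S)$, and it is entirely covered by (closures of) faces of $\mathcal V(S)\cap D$ that are missing from $G$. -/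

import Mathlib

open Set Topology

/-- The Euclidean plane. -/
abbrev Plane : Type := EuclideanSpace ℝ (Fin 2)

/-- `A` and `B` are disjoint nonempty open sets whose complement `(A ∪ B)ᶜ` is a nonempty
topological curve with `A` on one side and `B` on the other side: around each of its points there is
a local coordinate system in which the curve is the first axis, `A` is the upper side and `B` is the
lower side. The curve need not be connected, and its components may be closed or unbounded. -/
structure SeparatedByCurve (A B : Set Plane) : Prop where
  isOpen_left : IsOpen A
  isOpen_right : IsOpen B
  disjoint : Disjoint A B
  curve_nonempty : (A ∪ B)ᶜ.Nonempty
  exists_chart : ∀ x ∈ (A ∪ B)ᶜ, ∃ φ : OpenPartialHomeomorph Plane (ℝ × ℝ),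
    x ∈ φ.source ∧ ∀ y ∈ φ.source, (y ∈ A ↔ 0 < (φ y).2) ∧ (y ∈ B ↔ (φ y).2 < 0)

/-- The sets `J` and `K` cross transversally at `x`: in suitable local coordinates around `x` they
are the two coordinate axes. -/
def CrossTransversallyAt (J K : Set Plane) (x : Plane) : Prop :=
  ∃ φ : OpenPartialHomeomorph Plane (ℝ × ℝ), x ∈ φ.source ∧ φ x = (0, 0) ∧
    ∀ y ∈ φ.source, (y ∈ J ↔ (φ y).2 = 0) ∧ (y ∈ K ↔ (φ y).1 = 0)

/-- The bisector `J(p,q)` determined by a family of dominance regions `dom p q = D(p,q)`: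
what `D(p,q)` and `D(q,p)` leave of the plane. -/
def bisectorOf {ι : Type*} (dom : ι → ι → Set Plane) (p q : ι) : Set Plane :=
  (dom p q ∪ dom q p)ᶜ

/-- The Voronoi region `VR(p,S)` determined by a family of dominance regions. -/
def regionOf {ι : Type*} (dom : ι → ι → Set Plane) (p : ι) (S : Set ι) : Set Plane :=
  ⋂ q ∈ S \ {p}, dom p q

/-- A (relaxed) abstract bisector system on the sites `ι`: the bisector of two sites is a curve,
possibly disconnected or closed, that separates their dominance regions, and the axioms
(A2) and (A4) hold. Values `dom p p` play no role. -/
structure BisectorSystem (ι : Type*) where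
  /-- the dominance region `D(p,q)` of `p` against `q` -/
  dom : ι → ι → Set Plane
  separated : ∀ p q, p ≠ q → SeparatedByCurve (dom p q) (dom q p)
  /-- (A2) -/
  mem_closure_region : ∀ S : Set ι, S.Nonempty → ∀ x, ∃ p ∈ S, x ∈ closure (regionOf dom p S)
  /-- (A4), finitely many intersection points -/
  finite_inter : ∀ p q s t, p ≠ q → s ≠ t → s(p, q) ≠ s(s, t) →
    (bisectorOf dom p q ∩ bisectorOf dom s t).Finite
  /-- (A4), transversality -/
  transversal : ∀ p q s t, p ≠ q → s ≠ t → s(p, q) ≠ s(s, t) →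
    ∀ x ∈ bisectorOf dom p q ∩ bisectorOf dom s t,
      CrossTransversallyAt (bisectorOf dom p q) (bisectorOf dom s t) x

namespace BisectorSystem

variable {ι : Type*} (B : BisectorSystem ι)

/-- The bisector `J(p,q)`. -/
def bisector (p q : ι) : Set Plane := bisectorOf B.dom p q

/-- The Voronoi region `VR(p,S)`. -/
def region (p : ι) (S : Set ι) : Set Plane := regionOf B.dom p S

/-- The Voronoi diagram `V(S)`. -/
def diagram (S : Set ι) : Set Plane := (⋃ p ∈ S, B.region p S)ᶜ

/-- General position: no three bisectors that involve one common site meet in a point. -/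
def GeneralPosition : Prop :=
  ∀ p q s t, q ≠ p → s ≠ p → t ≠ p → q ≠ s → q ≠ t → s ≠ t →
    B.bisector p q ∩ B.bisector p s ∩ B.bisector p t = ∅

/-- `f` is a face of `V(S) ∩ D` of site `p`, that is, a connected component of the part of the
Voronoi region of `p` inside `D`. -/
def IsVoronoiFace (S : Set ι) (D : Set Plane) (p : ι) (f : Set Plane) : Prop :=
  p ∈ S ∧ ∃ x ∈ B.region p S ∩ D, f = connectedComponentIn (B.region p S ∩ D) x

/-- `e` is a maximal arc of the bisector `J(p,q)` inside `D` that avoids the points of `V`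
(so each end of `e` is at a point of `V` or leaves `D`, unless `e` is a closed curve). -/
def IsArc (D V : Set Plane) (p q : ι) (e : Set Plane) : Prop :=
  p ≠ q ∧ ∃ x ∈ (B.bisector p q ∩ D) \ V,
    e = connectedComponentIn ((B.bisector p q ∩ D) \ V) x

end BisectorSystem

/-- A finite plane graph on the arrangement of the bisectors of `B`, truncated within the open set
`D`. Edges are taken without their end points, and only the vertices inside `D` are recorded: the
leaves are the points where edges reach the boundary of `D`. -/
structure ArrangementGraph {ι : Type*} (B : BisectorSystem ι) (D : Set Plane) where
  vertices : Set Plane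
  edges : Set (Set Plane)
  finite_vertices : vertices.Finite
  finite_edges : edges.Finite
  vertices_subset : vertices ⊆ D
  /-- the vertices are vertices of the arrangement -/
  arrangement_vertex : ∀ v ∈ vertices, ∃ p q s t, p ≠ q ∧ s ≠ t ∧ s(p, q) ≠ s(s, t) ∧
    v ∈ B.bisector p q ∩ B.bisector s t
  /-- the edges are maximal bisector arcs between vertices -/
  edge_isArc : ∀ e ∈ edges, ∃ p q, B.IsArc D vertices p q e
  /-- edges do not cross -/
  edges_disjoint : edges.PairwiseDisjoint id

namespace ArrangementGraph

variable {ι : Type*} {B : BisectorSystem ι} {D : Set Plane} (G : ArrangementGraph B D)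

/-- The points of `D` on the graph. -/
def carrier : Set Plane := G.vertices ∪ ⋃₀ G.edges

/-- The set of the sites that are involved in the edges of the graph. -/
def sites : Set ι := {p | ∃ e ∈ G.edges, ∃ q, B.IsArc D G.vertices p q e}

/-- The faces of the graph in `D`. -/
def IsFace (f : Set Plane) : Prop :=
  ∃ x ∈ D \ G.carrier, f = connectedComponentIn (D \ G.carrier) x

/-- Some edge of the graph, on a bisector `J(p,q)`, bounds `f` and has the label `p` inside `f`. -/
def HasLabel (f : Set Plane) (p : ι) : Prop :=
  ∃ e ∈ G.edges, ∃ q, B.IsArc D G.vertices p q e ∧ (e ∩ closure (f ∩ B.dom p q)).Nonempty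

/-- `p` is the site of the face `f`: the bisectors bounding `f` have the label `p` inside `f`,
and no other label. -/
def IsSite (f : Set Plane) (p : ι) : Prop :=
  G.HasLabel f p ∧ ∀ q, G.HasLabel f q → q = p

/-- The point `v` is locally Voronoi: near `v` the graph is the Voronoi diagram of three sites whose
bisectors pass through `v`. -/
def IsLocallyVoronoi (v : Plane) : Prop :=
  ∃ p q s, p ≠ q ∧ q ≠ s ∧ p ≠ s ∧
    v ∈ B.bisector p q ∧ v ∈ B.bisector q s ∧ v ∈ B.bisector p s ∧
    ∃ N ∈ 𝓝 v, G.carrier ∩ N = B.diagram {p, q, s} ∩ N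

/-- The graph is Voronoi-like: its vertices inside `D` are locally Voronoi and, if the graph is
disconnected, the arcs (from possibly different components of the graph) that bound one
face have consistent labels inside that face. -/
structure IsVoronoiLike : Prop where
  locallyVoronoi : ∀ v ∈ G.vertices, G.IsLocallyVoronoi v
  consistent : ¬ IsPreconnected G.carrier →
    ∀ f, G.IsFace f → ∀ p q, G.HasLabel f p → G.HasLabel f q → p = q

/-- The face `f` of `V(S) ∩ D`, where `S` is the set of sites of the graph, is missing from the graph:
it is covered by (closures of) faces of the graph whose site is not the site of `f`. -/
def IsMissing (f : Set Plane) : Prop :=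
  ∃ p, B.IsVoronoiFace G.sites D p f ∧
    f ⊆ ⋃ g ∈ {g | G.IsFace g ∧ ¬ G.IsSite g p}, closure g

end ArrangementGraph

/-!
The theorem rests on a fact about the boundary of a face `f` of the graph with site `p`
(`ArrangementGraph.IsSite.exists_mem_bisector`): inside `D`, every boundary point of `f` lies on a
bisector `J(p,q)` with `q ∈ S`, `q ≠ p`, where `S` is the set of sites of the graph. On an edge this is
because one side of the edge locally belongs to `f`, so `p` is one of the two sites of the edge. At a
vertex it follows by closedness of the bisectors, since edges of the boundary of `f` accumulate there:
otherwise `f` would fill a punctured disc around the vertex, whereas the local diagram has at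
least two regions there.

As `VR(p,S)` avoids all these bisectors, a component of `VR(p,S) ∩ D` that meets `f` cannot leave `f`
(`IsSite.voronoiFace_subset`). So if `r` meets `VR(p,S)`, the first alternative holds. If not, every
point of `r` is in the closure of a face of `V(S) ∩ D` (`BisectorSystem.exists_isVoronoiFace_mem_closure`),
which then meets `r`, has a site `q ≠ p`, and by the same fact meets no face of the graph of site `q`.
Since every point of `D` is in the closure of some face of the graph (`exists_isFace_mem_closure`), such
a face of `V(S) ∩ D` is missing from the graph.

The two closure statements ask for one connected piece of a region that accumulates at the given point.
General position leaves at most three relevant sites near a point, and the charts of the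
bisectors supply the piece: a disc, a half disc, or a quadrant between two transversal bisectors.
-/

/-! ### Preconnected pieces in local coordinates -/

lemma OpenPartialHomeomorph.exists_nhds_isPreconnected_inter_preimage_convex
    (φ : OpenPartialHomeomorph Plane (ℝ × ℝ)) {x : Plane} (hx : x ∈ φ.source)
    {U : Set Plane} (hU : U ∈ 𝓝 x) :
    ∃ W ∈ 𝓝 x, W ⊆ U ∧ W ⊆ φ.source ∧
      ∀ C : Set (ℝ × ℝ), Convex ℝ C → IsPreconnected (W ∩ φ ⁻¹' C) := by
  have h1 : φ.target ∩ φ.symm ⁻¹' U ∈ 𝓝 (φ x) := by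
    refine Filter.inter_mem (φ.open_target.mem_nhds (φ.map_source hx)) ?_
    have := φ.symm.continuousAt (x := φ x) (φ.map_source hx)
    refine this ?_
    rwa [φ.left_inv hx]
  obtain ⟨ε, hε, hball⟩ := Metric.mem_nhds_iff.1 h1
  have key : ∀ C : Set (ℝ × ℝ), φ.source ∩ φ ⁻¹' Metric.ball (φ x) ε ∩ φ ⁻¹' C
      = φ.symm '' (Metric.ball (φ x) ε ∩ C) := by
    intro C
    ext y
    constructor
    · rintro ⟨⟨hy, hyb⟩, hyC⟩
      exact ⟨φ y, ⟨hyb, hyC⟩, φ.left_inv hy⟩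
    · rintro ⟨z, ⟨hzb, hzC⟩, rfl⟩
      have hz := (hball hzb).1
      refine ⟨⟨φ.map_target hz, ?_⟩, ?_⟩ <;> simpa only [mem_preimage, φ.right_inv hz]
  refine ⟨φ.source ∩ φ ⁻¹' Metric.ball (φ x) ε, ?_, ?_, inter_subset_left, ?_⟩
  · exact Filter.inter_mem (φ.open_source.mem_nhds hx)
      (φ.continuousAt hx (Metric.ball_mem_nhds _ hε))
  · rintro y ⟨hy, hyb⟩
    simpa only [mem_preimage, φ.left_inv hy] using (hball hyb).2
  · intro C hC
    rw [key]
    refine (((convex_ball _ _).inter hC).isPreconnected).image _ (φ.continuousOn_symm.mono ?_)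
    exact fun z hz => (hball hz.1).1

lemma OpenPartialHomeomorph.mem_closure_preimage (φ : OpenPartialHomeomorph Plane (ℝ × ℝ))
    {x : Plane} (hx : x ∈ φ.source) {C : Set (ℝ × ℝ)} (hC : φ x ∈ closure C) :
    x ∈ closure (φ.source ∩ φ ⁻¹' C) := by
  rw [mem_closure_iff_nhds]
  intro V hV
  have h1 : φ.target ∩ φ.symm ⁻¹' V ∈ 𝓝 (φ x) := by
    refine Filter.inter_mem (φ.open_target.mem_nhds (φ.map_source hx)) ?_
    refine φ.symm.continuousAt (x := φ x) (φ.map_source hx) ?_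
    rwa [φ.left_inv hx]
  obtain ⟨z, ⟨hzt, hzV⟩, hzC⟩ := mem_closure_iff_nhds.1 hC _ h1
  refine ⟨φ.symm z, hzV, φ.map_target hzt, ?_⟩
  simpa only [mem_preimage, φ.right_inv hzt]

lemma mem_closure_of_forall_add_smul_mem {E : Type*} [AddCommGroup E] [Module ℝ E]
    [TopologicalSpace E] [ContinuousAdd E] [ContinuousSMul ℝ E] {C : Set E} {z : E} (v : E)
    (h : ∀ t : ℝ, 0 < t → z + t • v ∈ C) : z ∈ closure C := by
  have : Filter.Tendsto (fun t : ℝ => z + t • v) (𝓝[>] 0) (𝓝 z) := by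
    have hc : Continuous fun t : ℝ => z + t • v := by fun_prop
    simpa using (hc.tendsto 0).mono_left nhdsWithin_le_nhds
  exact mem_closure_of_tendsto this (eventually_mem_nhdsWithin.mono fun t ht => h t ht)

lemma mem_closure_nhds_inter {X : Type*} [TopologicalSpace X] {x : X} {W A : Set X}
    (hW : W ∈ 𝓝 x) (hA : x ∈ closure A) : x ∈ closure (W ∩ A) := by
  rw [mem_closure_iff_nhds] at hA ⊢
  intro V hV
  obtain ⟨y, ⟨hyV, hyW⟩, hyA⟩ := hA _ (Filter.inter_mem hV hW)
  exact ⟨y, hyV, hyW, hyA⟩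

lemma isPreconnected_ball_diff_center (x : Plane) (ε : ℝ) (hε : 0 < ε) :
    IsPreconnected (Metric.ball x ε \ {x}) := by
  have hrank : 1 < Module.rank ℝ Plane := by
    rw [← Module.finrank_eq_rank]; simp
  have h0 := (isConnected_compl_singleton_of_one_lt_rank hrank (0 : Plane)).isPreconnected
  have himg : OpenPartialHomeomorph.univBall x ε '' {0}ᶜ = Metric.ball x ε \ {x} := by
    set φ := OpenPartialHomeomorph.univBall x ε with hφ
    have hs : φ.source = univ := OpenPartialHomeomorph.univBall_source x ε
    have ht : φ.target = Metric.ball x ε := OpenPartialHomeomorph.univBall_target x hε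
    have hz : φ 0 = x := OpenPartialHomeomorph.univBall_apply_zero x ε
    ext y
    constructor
    · rintro ⟨z, hz0, rfl⟩
      refine ⟨ht ▸ φ.map_source (hs ▸ mem_univ z), fun h => hz0 ?_⟩
      exact φ.injOn (hs ▸ mem_univ z) (hs ▸ mem_univ 0) (h.trans hz.symm)
    · rintro ⟨hy, hyx⟩
      refine ⟨φ.symm y, fun h => hyx ?_, φ.right_inv (ht ▸ hy)⟩
      rw [mem_singleton_iff] at h ⊢
      rw [← hz, ← h, φ.right_inv (ht ▸ hy)]
  rw [← himg]
  exact h0.image _ (OpenPartialHomeomorph.continuous_univBall x ε).continuousOn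

/-! ### Sides of a separating curve -/

namespace SeparatedByCurve

variable {A B : Set Plane}

lemma symm (h : SeparatedByCurve A B) : SeparatedByCurve B A where
  isOpen_left := h.isOpen_right
  isOpen_right := h.isOpen_left
  disjoint := h.disjoint.symm
  curve_nonempty := by simpa only [union_comm] using h.curve_nonempty
  exists_chart := by
    intro x hx
    rw [union_comm] at hx
    obtain ⟨φ, hxs, hφ⟩ := h.exists_chart x hx
    let σ : (ℝ × ℝ) ≃ₜ (ℝ × ℝ) := (Homeomorph.refl ℝ).prodCongr (Homeomorph.neg ℝ)
    refine ⟨φ.trans σ.toOpenPartialHomeomorph, by simpa using hxs, fun y hy => ?_⟩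
    have hy' : y ∈ φ.source := by simpa using hy
    simpa [σ] using (hφ y hy').symm

lemma mem_closure_left (h : SeparatedByCurve A B) {x : Plane} (hx : x ∈ (A ∪ B)ᶜ) :
    x ∈ closure A := by
  obtain ⟨φ, hxs, hφ⟩ := h.exists_chart x hx
  have h2 : (φ x).2 = 0 := by
    have := hφ x hxs
    simp only [mem_compl_iff, mem_union, not_or] at hx
    exact le_antisymm (not_lt.1 fun h => hx.1 (this.1.2 h)) (not_lt.1 fun h => hx.2 (this.2.2 h))
  have : φ x ∈ closure {z : ℝ × ℝ | 0 < z.2} :=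
    mem_closure_of_forall_add_smul_mem (0, 1) fun t ht => by simpa [h2] using ht
  refine closure_mono ?_ (φ.mem_closure_preimage hxs this)
  exact fun y hy => ((hφ y hy.1).1).2 hy.2

/-- Near a point of the curve, each side and the curve itself consist of one piece. -/
lemma exists_nhds_isPreconnected (h : SeparatedByCurve A B) {x : Plane} (hx : x ∈ (A ∪ B)ᶜ)
    {U : Set Plane} (hU : U ∈ 𝓝 x) :
    ∃ W ∈ 𝓝 x, W ⊆ U ∧ IsPreconnected (W ∩ A) ∧ IsPreconnected (W ∩ B) ∧
      IsPreconnected (W ∩ (A ∪ B)ᶜ) := by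
  obtain ⟨φ, hxs, hφ⟩ := h.exists_chart x hx
  obtain ⟨W, hW, hWU, hWs, hconn⟩ :=
    φ.exists_nhds_isPreconnected_inter_preimage_convex hxs hU
  have hlin : IsLinearMap ℝ (Prod.snd : ℝ × ℝ → ℝ) := (LinearMap.snd ℝ ℝ ℝ).isLinear
  have hA : W ∩ A = W ∩ φ ⁻¹' {z | 0 < z.2} := by
    ext y; exact and_congr_right fun hy => (hφ y (hWs hy)).1
  have hB : W ∩ B = W ∩ φ ⁻¹' {z | z.2 < 0} := by
    ext y; exact and_congr_right fun hy => (hφ y (hWs hy)).2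
  have hJ : W ∩ (A ∪ B)ᶜ = W ∩ φ ⁻¹' {z | z.2 = 0} := by
    ext y
    refine and_congr_right fun hy => ?_
    rw [mem_compl_iff, mem_union, (hφ y (hWs hy)).1, (hφ y (hWs hy)).2, mem_preimage, mem_ofPred_eq]
    rw [or_comm, ← ne_iff_lt_or_gt, not_not]
  refine ⟨W, hW, hWU, ?_, ?_, ?_⟩
  · rw [hA]; exact hconn _ (convex_halfSpace_gt hlin 0)
  · rw [hB]; exact hconn _ (convex_halfSpace_lt hlin 0)
  · rw [hJ]; exact hconn _ (convex_hyperplane hlin 0)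

/-- The sides of a separating curve are regular open sets. -/
lemma subset_left_of_subset_closure (h : SeparatedByCurve A B) {O : Set Plane} (hO : IsOpen O)
    (hOA : O ⊆ closure A) : O ⊆ A := by
  have hdisj : Disjoint O B :=
    ((h.disjoint.closure_left h.isOpen_right).mono_left hOA)
  intro y hy
  by_contra hyA
  have hyB : y ∉ B := fun hyB => disjoint_left.1 hdisj hy hyB
  have hcl : y ∈ closure B := h.symm.mem_closure_left (by
    simp only [mem_compl_iff, mem_union, not_or]; exact ⟨hyB, hyA⟩)
  exact disjoint_left.1 (hdisj.closure_right hO) hy hcl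

/-- In coordinates in which the curve is the zero set of a coordinate function `u`, the side `A`
is locally one of the half planes `u > 0` and `u < 0`. -/
lemma exists_sign (h : SeparatedByCurve A B) {x : Plane} (hx : x ∈ (A ∪ B)ᶜ)
    {W : Set Plane} (hW : W ∈ 𝓝 x) (u : Plane → ℝ)
    (hu : ∀ y ∈ W, y ∈ (A ∪ B)ᶜ ↔ u y = 0)
    (hconn : ∀ σ : ℝ, IsPreconnected (W ∩ {y | 0 < σ * u y})) :
    ∃ σ : ℝ, σ ≠ 0 ∧ W ∩ {y | 0 < σ * u y} ⊆ A := by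
  obtain ⟨y, hyW, hyA⟩ :=
    mem_closure_iff_nhds.1 (h.mem_closure_left hx) W hW
  have hy0 : u y ≠ 0 := fun h0 => ((hu y hyW).2 h0) (Or.inl hyA)
  refine ⟨u y, hy0, (hconn _).subset_left_of_subset_union h.isOpen_left h.isOpen_right
    h.disjoint ?_ ⟨y, ⟨hyW, mul_self_pos.2 hy0⟩, hyA⟩⟩
  rintro z ⟨hzW, hz⟩
  by_contra hzJ
  have := (hu z hzW).1 hzJ
  simp [this] at hz

end SeparatedByCurve

/-- Where two separating curves cross transversally at `x`, the intersection of a side of the one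
with a side of the other contains a quadrant at `x`. -/
lemma CrossTransversallyAt.exists_quadrant {A A' C C' : Set Plane} {x : Plane}
    (hA : SeparatedByCurve A A') (hC : SeparatedByCurve C C')
    (hxA : x ∈ (A ∪ A')ᶜ) (hxC : x ∈ (C ∪ C')ᶜ)
    (h : CrossTransversallyAt (A ∪ A')ᶜ (C ∪ C')ᶜ x) {U : Set Plane} (hU : U ∈ 𝓝 x) :
    ∃ P ⊆ U ∩ (A ∩ C), IsPreconnected P ∧ x ∈ closure P := by
  obtain ⟨φ, hxs, hφx, hφ⟩ := h
  obtain ⟨W, hW, hWU, hWs, hconn⟩ :=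
    φ.exists_nhds_isPreconnected_inter_preimage_convex hxs hU
  have hconv₁ (σ : ℝ) : Convex ℝ {z : ℝ × ℝ | 0 < σ * z.1} :=
    convex_halfSpace_gt (σ • LinearMap.fst ℝ ℝ ℝ).isLinear 0
  have hconv₂ (σ : ℝ) : Convex ℝ {z : ℝ × ℝ | 0 < σ * z.2} :=
    convex_halfSpace_gt (σ • LinearMap.snd ℝ ℝ ℝ).isLinear 0
  obtain ⟨σ, hσ, hσA⟩ := hA.exists_sign hxA hW (fun y => (φ y).2)
    (fun y hy => (hφ y (hWs hy)).1) fun σ => hconn _ (hconv₂ σ)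
  obtain ⟨τ, hτ, hτC⟩ := hC.exists_sign hxC hW (fun y => (φ y).1)
    (fun y hy => (hφ y (hWs hy)).2) fun σ => hconn _ (hconv₁ σ)
  refine ⟨W ∩ φ ⁻¹' ({z | 0 < σ * z.2} ∩ {z | 0 < τ * z.1}), ?_,
    hconn _ ((hconv₂ σ).inter (hconv₁ τ)), ?_⟩
  · rintro y ⟨hyW, h2, h1⟩
    exact ⟨hWU hyW, hσA ⟨hyW, h2⟩, hτC ⟨hyW, h1⟩⟩
  · have hcl : φ x ∈ closure ({z : ℝ × ℝ | 0 < σ * z.2} ∩ {z | 0 < τ * z.1}) := by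
      refine mem_closure_of_forall_add_smul_mem (τ, σ) fun t ht => ?_
      rw [hφx]
      constructor
      · have := mul_pos ht (mul_self_pos.2 hσ)
        simp only [mem_ofPred_eq, Prod.smul_mk, Prod.mk_add_mk, smul_eq_mul]
        linarith
      · have := mul_pos ht (mul_self_pos.2 hτ)
        simp only [mem_ofPred_eq, Prod.smul_mk, Prod.mk_add_mk, smul_eq_mul]
        linarith
    exact mem_closure_nhds_inter hW
      (closure_mono inter_subset_right (φ.mem_closure_preimage hxs hcl))

/-! ### Voronoi regions near a point -/

namespace BisectorSystem

variable {ι : Type*} (B : BisectorSystem ι)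

lemma bisector_comm (p q : ι) : B.bisector p q = B.bisector q p := by
  simp only [bisector, bisectorOf, union_comm]

lemma region_mono {p : ι} {S T : Set ι} (h : T ⊆ S) : B.region p S ⊆ B.region p T :=
  biInter_subset_biInter_left (sdiff_subset_sdiff_left h)

lemma region_subset_dom {p q : ι} {S : Set ι} (hq : q ∈ S) (h : q ≠ p) :
    B.region p S ⊆ B.dom p q :=
  biInter_subset_of_mem ⟨hq, h⟩

lemma disjoint_region {p q : ι} {S : Set ι} (hp : p ∈ S) (hq : q ∈ S) (h : p ≠ q) :
    Disjoint (B.region p S) (B.region q S) :=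
  (B.separated p q h).disjoint.mono (B.region_subset_dom hq h.symm) (B.region_subset_dom hp h)

lemma isOpen_region [Finite ι] (p : ι) (S : Set ι) : IsOpen (B.region p S) :=
  (toFinite _).isOpen_biInter fun q hq => (B.separated p q (fun h => hq.2 h.symm)).isOpen_left

lemma isClosed_bisector {p q : ι} (h : p ≠ q) : IsClosed (B.bisector p q) :=
  ((B.separated p q h).isOpen_left.union (B.separated p q h).isOpen_right).isClosed_compl

lemma disjoint_bisector_region {p q : ι} {S : Set ι} (hq : q ∈ S) (h : q ≠ p) :
    Disjoint (B.bisector p q) (B.region p S) :=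
  disjoint_compl_left.mono_right ((B.region_subset_dom hq h).trans subset_union_left)

lemma mem_bisector_of_mem_closure_region {p q : ι} {S : Set ι} (hp : p ∈ S) (hq : q ∈ S)
    (h : p ≠ q) {x : Plane} (hxp : x ∈ closure (B.region p S))
    (hxq : x ∈ closure (B.region q S)) : x ∈ B.bisector p q := by
  have hs := B.separated p q h
  have h1 := closure_mono (B.region_subset_dom hq h.symm) hxp
  have h2 := closure_mono (B.region_subset_dom hp h) hxq
  rintro (hx | hx)
  · exact disjoint_left.1 (hs.disjoint.closure_right hs.isOpen_left) hx h2
  · exact disjoint_left.1 (hs.disjoint.closure_left hs.isOpen_right) h1 hx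

/-- Where the bisectors `J(p,q)` and `J(p,s)` meet, `D(p,q) ∩ D(p,s)` contains a quadrant. -/
lemma exists_quadrant {p q s : ι} (hpq : p ≠ q) (hps : p ≠ s) (hqs : q ≠ s) {x : Plane}
    (hq : x ∈ B.bisector p q) (hs : x ∈ B.bisector p s) {U : Set Plane} (hU : U ∈ 𝓝 x) :
    ∃ P ⊆ U ∩ (B.dom p q ∩ B.dom p s), IsPreconnected P ∧ x ∈ closure P := by
  refine CrossTransversallyAt.exists_quadrant (B.separated p q hpq) (B.separated p s hps) hq hs
    (B.transversal p q p s hpq hps ?_ x ⟨hq, hs⟩) hU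
  simpa [Sym2.eq_iff, hqs] using fun h => absurd h hps

/-- Every point is a limit of one connected piece, arbitrarily near it, of some region of `V(S)`.
By general position, the regions of at most three sites accumulate at the point, and near it they
agree with the regions of these sites alone, each of which contains a disc, a half disc or (by
transversality) a quadrant. -/
lemma exists_isPreconnected_subset_region [Finite ι] (hB : B.GeneralPosition) {S : Set ι}
    (hS : S.Nonempty) (x : Plane) {U : Set Plane} (hU : U ∈ 𝓝 x) :
    ∃ p ∈ S, ∃ P ⊆ U ∩ B.region p S, IsPreconnected P ∧ x ∈ closure P := by
  -- the sites whose regions accumulate at `x`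
  set T : Set ι := {q ∈ S | x ∈ closure (B.region q S)} with hT
  have hTS : T ⊆ S := fun q hq => hq.1
  obtain ⟨p, hpS, hpx⟩ := B.mem_closure_region S hS x
  have hpT : p ∈ T := ⟨hpS, hpx⟩
  have hbis : ∀ q ∈ T, q ≠ p → x ∈ B.bisector p q := fun q hq hqp =>
    B.mem_bisector_of_mem_closure_region hpS hq.1 hqp.symm hpx hq.2
  -- a neighbourhood in which no other region occurs
  obtain ⟨N, hNU, hNo, hxN, hN⟩ : ∃ N ⊆ U, IsOpen N ∧ x ∈ N ∧
      ∀ q ∈ S, ∀ y ∈ N, y ∈ closure (B.region q S) → q ∈ T := by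
    have hfin : (⋃ q ∈ S \ T, closure (B.region q S))ᶜ ∈ 𝓝 x := by
      refine IsOpen.mem_nhds ((toFinite _).isClosed_biUnion
        fun q _ => isClosed_closure).isOpen_compl ?_
      simp only [mem_compl_iff, mem_iUnion, not_exists]
      exact fun q hq hx => hq.2 ⟨hq.1, hx⟩
    obtain ⟨N, hN, hNo, hxN⟩ := mem_nhds_iff.1 (Filter.inter_mem hU hfin)
    refine ⟨N, fun y hy => (hN hy).1, hNo, hxN, fun q hq y hy hyq => ?_⟩
    by_contra hqT
    exact (hN hy).2 (mem_biUnion (show q ∈ S \ T from ⟨hq, hqT⟩) hyq)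
  have hcl : N ∩ B.region p T ⊆ closure (B.region p S) := by
    rintro y ⟨hyN, hyp⟩
    obtain ⟨q, hqS, hyq⟩ := B.mem_closure_region S hS y
    have hqT := hN q hqS y hyN hyq
    by_cases hqp : q = p
    · exact hqp ▸ hyq
    · exact absurd (closure_mono (B.region_mono hTS) hyq) (disjoint_left.1
        ((B.disjoint_region hpT hqT (Ne.symm hqp)).closure_right (B.isOpen_region p T)) hyp)
  have hreg : N ∩ B.region p T ⊆ B.region p S := by
    refine subset_iInter₂ fun q hq => ?_
    refine (B.separated p q fun h => hq.2 h.symm).subset_left_of_subset_closure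
      (hNo.inter (B.isOpen_region p T)) (hcl.trans (closure_mono ?_))
    exact B.region_subset_dom hq.1 hq.2
  suffices h : ∃ P ⊆ N ∩ B.region p T, IsPreconnected P ∧ x ∈ closure P by
    obtain ⟨P, hP, hPc, hxP⟩ := h
    exact ⟨p, hpS, P, fun y hy => ⟨hNU (hP hy).1, hreg (hP hy)⟩, hPc, hxP⟩
  have hNx : N ∈ 𝓝 x := hNo.mem_nhds hxN
  by_cases h1 : ∃ q ∈ T, q ≠ p
  · obtain ⟨q, hqT, hqp⟩ := h1
    by_cases h2 : ∃ s ∈ T, s ≠ p ∧ s ≠ q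
    · obtain ⟨s, hsT, hsp, hsq⟩ := h2
      obtain ⟨P, hP, hPc, hxP⟩ := B.exists_quadrant hqp.symm hsp.symm hsq.symm
        (hbis q hqT hqp) (hbis s hsT hsp) hNx
      refine ⟨P, fun y hy => ⟨(hP hy).1, mem_iInter₂.2 fun t ht => ?_⟩, hPc, hxP⟩
      -- general position excludes a fourth site
      obtain rfl | htq := eq_or_ne t q
      · exact (hP hy).2.1
      obtain rfl | hts := eq_or_ne t s
      · exact (hP hy).2.2
      have : x ∈ B.bisector p q ∩ B.bisector p s ∩ B.bisector p t :=
        ⟨⟨hbis q hqT hqp, hbis s hsT hsp⟩, hbis t ht.1 ht.2⟩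
      rw [hB p q s t hqp hsp ht.2 hsq.symm htq.symm hts.symm] at this
      exact this.elim
    · have hs := B.separated p q hqp.symm
      have hx := hbis q hqT hqp
      obtain ⟨W, hW, hWN, hWA, -⟩ := hs.exists_nhds_isPreconnected hx hNx
      refine ⟨W ∩ B.dom p q, fun y hy => ⟨hWN hy.1, mem_iInter₂.2 fun t ht => ?_⟩, hWA,
        mem_closure_nhds_inter hW (hs.mem_closure_left hx)⟩
      obtain rfl | htq := eq_or_ne t q
      · exact hy.2
      · exact absurd ⟨t, ht.1, ht.2, htq⟩ h2
  · obtain ⟨ε, hε, hball⟩ := Metric.mem_nhds_iff.1 hNx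
    refine ⟨Metric.ball x ε, fun y hy => ⟨hball hy, mem_iInter₂.2 fun t ht => ?_⟩,
      Metric.isPreconnected_ball, subset_closure (Metric.mem_ball_self hε)⟩
    exact absurd ⟨t, ht.1, ht.2⟩ h1

/-- Every point of `D` lies in the closure of a face of `V(S) ∩ D`. -/
lemma exists_isVoronoiFace_mem_closure [Finite ι] (hB : B.GeneralPosition) {S : Set ι}
    (hS : S.Nonempty) {D : Set Plane} (hD : IsOpen D) {x : Plane} (hx : x ∈ D) :
    ∃ p f, B.IsVoronoiFace S D p f ∧ x ∈ closure f := by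
  obtain ⟨p, hp, P, hP, hPc, hxP⟩ :=
    B.exists_isPreconnected_subset_region hB hS x (hD.mem_nhds hx)
  rw [inter_comm] at hP
  obtain ⟨y, hy⟩ := closure_nonempty_iff.1 ⟨x, hxP⟩
  exact ⟨p, _, ⟨hp, y, hP hy, rfl⟩,
    closure_mono (hPc.subset_connectedComponentIn hy hP) hxP⟩

lemma IsVoronoiFace.isPreconnected {B : BisectorSystem ι} {S : Set ι} {D f : Set Plane} {p : ι}
    (h : B.IsVoronoiFace S D p f) : IsPreconnected f := by
  obtain ⟨-, x, -, rfl⟩ := h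
  exact isPreconnected_connectedComponentIn

lemma IsVoronoiFace.subset {B : BisectorSystem ι} {S : Set ι} {D f : Set Plane} {p : ι}
    (h : B.IsVoronoiFace S D p f) : f ⊆ B.region p S ∩ D := by
  obtain ⟨-, x, -, rfl⟩ := h
  exact connectedComponentIn_subset _ _

lemma IsVoronoiFace.isOpen [Finite ι] {B : BisectorSystem ι} {S : Set ι} {D f : Set Plane} {p : ι}
    (h : B.IsVoronoiFace S D p f) (hD : IsOpen D) : IsOpen f := by
  obtain ⟨-, x, -, rfl⟩ := h
  exact ((B.isOpen_region p S).inter hD).connectedComponentIn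

lemma IsArc.symm {B : BisectorSystem ι} {D V e : Set Plane} {p q : ι} (h : B.IsArc D V p q e) :
    B.IsArc D V q p e := by
  obtain ⟨hpq, x, hx, rfl⟩ := h
  rw [B.bisector_comm p q] at hx ⊢
  exact ⟨hpq.symm, x, hx, rfl⟩

lemma IsArc.subset {B : BisectorSystem ι} {D V e : Set Plane} {p q : ι} (h : B.IsArc D V p q e) :
    e ⊆ (B.bisector p q ∩ D) \ V := by
  obtain ⟨-, x, -, rfl⟩ := h
  exact connectedComponentIn_subset _ _

/-- An arc is relatively closed away from the vertices: it contains its limit points that are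
neither vertices nor outside `D`. -/
lemma IsArc.closure_inter_subset {B : BisectorSystem ι} {D V e : Set Plane} {p q : ι}
    (h : B.IsArc D V p q e) : closure e ∩ D ⊆ e ∪ V := by
  rintro y ⟨hye, hyD⟩
  rw [mem_union, or_iff_not_imp_right]
  intro hyV
  have hsub := h.subset
  have hyJ : y ∈ B.bisector p q := by
    have := closure_mono (hsub.trans fun z hz => hz.1.1) hye
    rwa [(B.isClosed_bisector h.1).closure_eq] at this
  obtain ⟨-, x, hx, rfl⟩ := h
  have hxe := mem_connectedComponentIn hx
  refine (isPreconnected_connectedComponentIn.subset_closure (subset_insert y _) ?_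
    ).subset_connectedComponentIn (mem_insert_of_mem _ hxe) ?_ (mem_insert y _)
  · exact insert_subset hye subset_closure
  · exact insert_subset ⟨⟨hyJ, hyD⟩, hyV⟩ hsub

end BisectorSystem

/-! ### Faces of the graph -/

namespace ArrangementGraph

variable {ι : Type*} {B : BisectorSystem ι} {D : Set Plane} (G : ArrangementGraph B D)

lemma isOpen_diff_carrier (hD : IsOpen D) : IsOpen (D \ G.carrier) := by
  have hcl : IsClosed (G.vertices ∪ ⋃ e ∈ G.edges, closure e) :=
    G.finite_vertices.isClosed.union (G.finite_edges.isClosed_biUnion fun _ _ => isClosed_closure)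
  convert hD.inter hcl.isOpen_compl using 1
  ext y
  simp only [carrier, mem_sdiff, mem_inter_iff, mem_compl_iff, and_congr_right_iff, not_iff_not]
  intro hyD
  simp only [mem_union, mem_iUnion, mem_sUnion, exists_prop]
  constructor
  · rintro (h | ⟨e, he, hy⟩)
    exacts [Or.inl h, Or.inr ⟨e, he, subset_closure hy⟩]
  · rintro (h | ⟨e, he, hy⟩)
    · exact Or.inl h
    · obtain ⟨p, q, ha⟩ := G.edge_isArc e he
      exact (ha.closure_inter_subset ⟨hy, hyD⟩).symm.imp id fun h => ⟨e, he, h⟩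

variable {G}

lemma IsFace.isOpen {f : Set Plane} (hf : G.IsFace f) (hD : IsOpen D) : IsOpen f := by
  obtain ⟨x, -, rfl⟩ := hf
  exact (G.isOpen_diff_carrier hD).connectedComponentIn

lemma IsFace.subset {f : Set Plane} (hf : G.IsFace f) : f ⊆ D \ G.carrier := by
  obtain ⟨x, -, rfl⟩ := hf
  exact connectedComponentIn_subset _ _

lemma IsFace.subset_of_inter_nonempty {f P : Set Plane} (hf : G.IsFace f) (hP : IsPreconnected P)
    (hPD : P ⊆ D \ G.carrier) (h : (P ∩ f).Nonempty) : P ⊆ f := by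
  obtain ⟨x, -, rfl⟩ := hf
  obtain ⟨y, hyP, hyf⟩ := h
  rw [connectedComponentIn_eq hyf]
  exact hP.subset_connectedComponentIn hyP hPD

lemma IsFace.eq_of_inter_nonempty {f g : Set Plane} (hf : G.IsFace f) (hg : G.IsFace g)
    (h : (f ∩ g).Nonempty) : f = g := by
  obtain ⟨x, -, rfl⟩ := hf
  obtain ⟨y, -, rfl⟩ := hg
  obtain ⟨z, hz, hz'⟩ := h
  rw [connectedComponentIn_eq hz, connectedComponentIn_eq hz']

/-- The closure of a face in `D` adds only points of the graph. -/
lemma IsFace.mem_carrier {f : Set Plane} (hf : G.IsFace f) (hD : IsOpen D) {x : Plane}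
    (hx : x ∈ closure f) (hxD : x ∈ D) (hxf : x ∉ f) : x ∈ G.carrier := by
  by_contra hxG
  have hg : G.IsFace (connectedComponentIn (D \ G.carrier) x) := ⟨x, ⟨hxD, hxG⟩, rfl⟩
  have hxg := mem_connectedComponentIn (show x ∈ D \ G.carrier from ⟨hxD, hxG⟩)
  have := mem_closure_iff.1 hx _ (hg.isOpen hD) hxg
  exact hxf ((hg.eq_of_inter_nonempty hf this) ▸ hxg)

lemma exists_isFace_mem_closure_of_isPreconnected {P : Set Plane} {x : Plane}
    (hP : IsPreconnected P) (hPD : P ⊆ D \ G.carrier) (hx : x ∈ closure P) :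
    ∃ g, G.IsFace g ∧ x ∈ closure g := by
  obtain ⟨y, hy⟩ := closure_nonempty_iff.1 ⟨x, hx⟩
  exact ⟨_, ⟨y, hPD hy, rfl⟩, closure_mono (hP.subset_connectedComponentIn hy hPD) hx⟩

/-- Near a point of an edge on `J(p,q)`, the graph is the bisector `J(p,q)`, and its complement
consists of one piece in `D(p,q)` and one piece in `D(q,p)`. -/
lemma exists_nhds_of_mem_edge (hD : IsOpen D) {e : Set Plane} (he : e ∈ G.edges) {p q : ι}
    (ha : B.IsArc D G.vertices p q e) {x : Plane} (hx : x ∈ e) :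
    ∃ W ∈ 𝓝 x, W ⊆ D ∧ W ∩ G.carrier = W ∩ B.bisector p q ∧
      IsPreconnected (W ∩ B.dom p q) ∧ IsPreconnected (W ∩ B.dom q p) := by
  obtain ⟨⟨hxJ, hxD⟩, hxV⟩ := ha.subset hx
  have hU : D ∩ (G.vertices ∪ ⋃ e' ∈ G.edges \ {e}, closure e')ᶜ ∈ 𝓝 x := by
    refine (hD.inter (G.finite_vertices.isClosed.union
      ((G.finite_edges.subset sdiff_subset).isClosed_biUnion
        fun _ _ => isClosed_closure)).isOpen_compl).mem_nhds ⟨hxD, ?_⟩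
    simp only [mem_compl_iff, mem_union, mem_iUnion, not_or, not_exists]
    refine ⟨hxV, fun e' he' hxe' => ?_⟩
    obtain ⟨a, b, hab⟩ := G.edge_isArc e' he'.1
    rcases hab.closure_inter_subset ⟨hxe', hxD⟩ with h | h
    · exact disjoint_left.1 (G.edges_disjoint he'.1 he he'.2) h hx
    · exact hxV h
  obtain ⟨W, hW, hWU, h1, h2, h3⟩ :=
    (B.separated p q ha.1).exists_nhds_isPreconnected hxJ hU
  refine ⟨W, hW, fun y hy => (hWU hy).1, ?_, h1, h2⟩
  ext y
  refine and_congr_right fun hyW => ?_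
  have hy := (hWU hyW).2
  simp only [mem_compl_iff, mem_union, mem_iUnion, not_or, not_exists] at hy
  constructor
  · rintro (h | ⟨e', he', hye'⟩)
    · exact absurd h hy.1
    · by_cases hee : e' = e
      · exact (ha.subset (hee ▸ hye')).1.1
      · exact absurd (subset_closure hye') (hy.2 e' ⟨he', hee⟩)
  · intro hyJ
    refine Or.inr ⟨e, he, ?_⟩
    have hsub : W ∩ B.bisector p q ⊆ (B.bisector p q ∩ D) \ G.vertices := fun z hz =>
      ⟨⟨hz.2, (hWU hz.1).1⟩, fun hzV => (hWU hz.1).2 (Or.inl hzV)⟩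
    have hxW : x ∈ W ∩ B.bisector p q := ⟨mem_of_mem_nhds hW, hxJ⟩
    have hcomp := h3.subset_connectedComponentIn hxW hsub
    obtain ⟨-, z, -, rfl⟩ := ha
    rw [connectedComponentIn_eq hx]
    exact hcomp ⟨hyW, hyJ⟩

/-- At a vertex of a Voronoi-like graph, two different regions of the local diagram contain a
quadrant each. -/
lemma exists_two_quadrants (hV : G.IsVoronoiLike) {v : Plane} (hv : v ∈ G.vertices) :
    ∃ (T : Set ι) (p q : ι), p ∈ T ∧ q ∈ T ∧ p ≠ q ∧
      (∃ N ∈ 𝓝 v, G.carrier ∩ N = B.diagram T ∩ N) ∧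
      ∀ U ∈ 𝓝 v, ∀ s ∈ ({p, q} : Set ι),
        ∃ P ⊆ U ∩ B.region s T, IsPreconnected P ∧ v ∈ closure P := by
  obtain ⟨p, q, s, hpq, hqs, hps, hJpq, hJqs, hJps, hN⟩ := hV.locallyVoronoi v hv
  refine ⟨{p, q, s}, p, q, by simp, by simp, hpq, hN, fun U hU t ht => ?_⟩
  rcases ht with rfl | rfl
  · obtain ⟨P, hP, hPc, hvP⟩ := B.exists_quadrant hpq hps hqs hJpq hJps hU
    refine ⟨P, fun y hy => ⟨(hP hy).1, mem_iInter₂.2 ?_⟩, hPc, hvP⟩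
    rintro u ⟨rfl | rfl | rfl, hu⟩
    exacts [absurd rfl hu, (hP hy).2.1, (hP hy).2.2]
  · rw [B.bisector_comm] at hJpq
    obtain ⟨P, hP, hPc, hvP⟩ := B.exists_quadrant hpq.symm hqs hps hJpq hJqs hU
    refine ⟨P, fun y hy => ⟨(hP hy).1, mem_iInter₂.2 ?_⟩, hPc, hvP⟩
    rintro u ⟨rfl | rfl | rfl, hu⟩
    exacts [(hP hy).2.1, absurd rfl hu, (hP hy).2.2]

/-- Every point of `D` lies in the closure of a face of the graph. -/
lemma exists_isFace_mem_closure (hD : IsOpen D) (hV : G.IsVoronoiLike) {x : Plane} (hx : x ∈ D) :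
    ∃ g, G.IsFace g ∧ x ∈ closure g := by
  by_cases hxG : x ∈ G.carrier
  · rcases hxG with hxV | ⟨e, he, hxe⟩
    · obtain ⟨T, p, q, hp, -, -, ⟨N, hN, hGN⟩, hquad⟩ := exists_two_quadrants hV hxV
      obtain ⟨P, hP, hPc, hxP⟩ :=
        hquad (N ∩ D) (Filter.inter_mem hN (hD.mem_nhds hx)) p (by simp)
      refine exists_isFace_mem_closure_of_isPreconnected hPc (fun y hy => ⟨(hP hy).1.2, ?_⟩) hxP
      intro hyG
      have : y ∈ B.diagram T ∩ N := hGN ▸ ⟨hyG, (hP hy).1.1⟩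
      exact this.1 (mem_biUnion hp (hP hy).2)
    · obtain ⟨p, q, ha⟩ := G.edge_isArc e he
      obtain ⟨W, hW, hWD, hWG, hconn, -⟩ := exists_nhds_of_mem_edge hD he ha hxe
      refine exists_isFace_mem_closure_of_isPreconnected hconn
        (fun y hy => ⟨hWD hy.1, fun hyG => ?_⟩)
        (mem_closure_nhds_inter hW ((B.separated p q ha.1).mem_closure_left (ha.subset hxe).1.1))
      have : y ∈ W ∩ B.bisector p q := hWG ▸ ⟨hy.1, hyG⟩
      exact this.2 (Or.inl hy.2)
  · exact ⟨_, ⟨x, ⟨hx, hxG⟩, rfl⟩,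
      subset_closure (mem_connectedComponentIn (show x ∈ D \ G.carrier from ⟨hx, hxG⟩))⟩

/-- An edge that reaches a face of site `p` lies on a bisector of `p` and another site involved
in the graph. -/
lemma IsSite.exists_mem_bisector_of_mem_edge (hD : IsOpen D) {f : Set Plane}
    (hf : G.IsFace f) {p : ι} (hp : G.IsSite f p) {e : Set Plane} (he : e ∈ G.edges) {x : Plane}
    (hxe : x ∈ e) (hx : x ∈ closure f) : ∃ q ∈ G.sites, q ≠ p ∧ x ∈ B.bisector p q := by
  -- one of the two sides of the edge at `x` meets `f`, hence belongs to `f`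
  have key : ∀ a b, B.IsArc D G.vertices a b e → ∀ W ∈ 𝓝 x, W ⊆ D →
      W ∩ G.carrier = W ∩ B.bisector a b → IsPreconnected (W ∩ B.dom a b) →
      (W ∩ B.dom a b ∩ f).Nonempty → a = p := by
    intro a b ha W hW hWD hWG hconn hne
    have hsub : W ∩ B.dom a b ⊆ f := by
      refine hf.subset_of_inter_nonempty hconn (fun y hy => ⟨hWD hy.1, fun hyG => ?_⟩) hne
      have : y ∈ W ∩ B.bisector a b := hWG ▸ ⟨hy.1, hyG⟩
      exact this.2 (Or.inl hy.2)
    have hsub' : W ∩ B.dom a b ⊆ f ∩ B.dom a b := fun y hy => ⟨hsub hy, hy.2⟩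
    refine hp.2 a ⟨e, he, b, ha, x, hxe, closure_mono hsub' ?_⟩
    exact mem_closure_nhds_inter hW
      ((B.separated a b ha.1).mem_closure_left (ha.subset hxe).1.1)
  obtain ⟨a, b, ha⟩ := G.edge_isArc e he
  have hxJ := (ha.subset hxe).1.1
  obtain ⟨W, hW, hWD, hWG, h1, h2⟩ := exists_nhds_of_mem_edge hD he ha hxe
  obtain ⟨y, hyW, hyf⟩ := mem_closure_iff_nhds.1 hx W hW
  have hyJ : y ∉ B.bisector a b := fun h =>
    (hf.subset hyf).2 ((show y ∈ W ∩ G.carrier from hWG ▸ ⟨hyW, h⟩).2)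
  rcases not_not.1 hyJ with hy | hy
  · obtain rfl := key a b ha W hW hWD hWG h1 ⟨y, ⟨hyW, hy⟩, hyf⟩
    exact ⟨b, ⟨e, he, a, ha.symm⟩, ha.1.symm, hxJ⟩
  · obtain rfl := key b a ha.symm W hW hWD (B.bisector_comm a b ▸ hWG) h2 ⟨y, ⟨hyW, hy⟩, hyf⟩
    exact ⟨a, ⟨e, he, b, ha⟩, ha.1, B.bisector_comm a b ▸ hxJ⟩

/-- Inside `D`, the boundary of a face of site `p` lies on bisectors of `p` with other sites involved
in the graph. -/
lemma IsSite.exists_mem_bisector [Finite ι] (hD : IsOpen D) (hV : G.IsVoronoiLike) {f : Set Plane}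
    (hf : G.IsFace f) {p : ι} (hp : G.IsSite f p) {x : Plane} (hx : x ∈ closure f) (hxD : x ∈ D)
    (hxf : x ∉ f) : ∃ q ∈ G.sites, q ≠ p ∧ x ∈ B.bisector p q := by
  rcases hf.mem_carrier hD hx hxD hxf with hxV | ⟨e, he, hxe⟩
  swap
  · exact hp.exists_mem_bisector_of_mem_edge hD hf he hxe hx
  -- At a vertex `x`, the boundary points of the face on nearby edges accumulate. Otherwise the face
  -- fills a punctured disc at `x`, which meets two regions of the local diagram.
  by_contra hno
  have hKcl : IsClosed (⋃ q ∈ G.sites \ {p}, B.bisector p q) :=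
    (toFinite _).isClosed_biUnion fun q hq => B.isClosed_bisector (Ne.symm hq.2)
  have hxK : x ∉ ⋃ q ∈ G.sites \ {p}, B.bisector p q := by
    simp only [mem_iUnion, not_exists]
    exact fun q hq hxq => hno ⟨q, hq.1, hq.2, hxq⟩
  obtain ⟨T, a, b, ha, hb, hab, ⟨N, hN, hGN⟩, hquad⟩ := exists_two_quadrants hV hxV
  have hVx : (G.vertices \ {x})ᶜ ∈ 𝓝 x :=
    (G.finite_vertices.subset sdiff_subset).isClosed.isOpen_compl.mem_nhds fun h => h.2 rfl
  obtain ⟨ε, hε, hball⟩ := Metric.mem_nhds_iff.1 (Filter.inter_mem (Filter.inter_mem hN hVx)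
    (Filter.inter_mem (hD.mem_nhds hxD) (hKcl.isOpen_compl.mem_nhds hxK)))
  have hpunct := isPreconnected_ball_diff_center x ε hε
  have hsub : Metric.ball x ε \ {x} ⊆ f := by
    refine hpunct.subset_of_closure_inter_subset (hf.isOpen hD) ?_ ?_
    · obtain ⟨y, hyb, hyf⟩ := mem_closure_iff_nhds.1 hx _ (Metric.ball_mem_nhds x hε)
      exact ⟨y, ⟨hyb, fun h => hxf (h ▸ hyf)⟩, hyf⟩
    · rintro y ⟨hyf, hyb, hyx⟩
      obtain ⟨⟨-, hyV⟩, hyD, hyK⟩ := hball hyb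
      by_contra hy
      rcases hf.mem_carrier hD hyf hyD hy with hyV' | ⟨e, he, hye⟩
      · exact hyV ⟨hyV', hyx⟩
      · obtain ⟨q, hq, hqp, hyq⟩ := hp.exists_mem_bisector_of_mem_edge hD hf he hye hyf
        exact hyK (mem_biUnion (show q ∈ G.sites \ {p} from ⟨hq, hqp⟩) hyq)
  have hcover : Metric.ball x ε \ {x} ⊆ B.region a T ∪ ⋃ s ∈ T \ {a}, B.region s T := by
    intro y hy
    have hyG : y ∉ B.diagram T := fun h =>
      (hf.subset (hsub hy)).2
        (hGN.ge ⟨h, (hball hy.1).1.1⟩ : y ∈ G.carrier ∩ N).1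
    obtain ⟨s, hs, hys⟩ := mem_iUnion₂.1 (not_not.1 hyG)
    obtain rfl | hsa := eq_or_ne s a
    · exact Or.inl hys
    · exact Or.inr (mem_biUnion (show s ∈ T \ {a} from ⟨hs, hsa⟩) hys)
  have hmeet : ∀ s ∈ ({a, b} : Set ι), s ∈ T →
      ((Metric.ball x ε \ {x}) ∩ B.region s T).Nonempty := by
    intro s hs hsT
    obtain ⟨P, hP, -, hxP⟩ := hquad _ (Metric.ball_mem_nhds x hε) s hs
    obtain ⟨y, hy⟩ := closure_nonempty_iff.1 ⟨x, hxP⟩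
    refine ⟨y, ⟨(hP hy).1, ?_⟩, (hP hy).2⟩
    rintro rfl
    have : y ∈ B.diagram T ∩ N := hGN ▸ ⟨Or.inl hxV, mem_of_mem_nhds hN⟩
    exact this.1 (mem_biUnion hsT (hP hy).2)
  have hdisj : Disjoint (B.region a T) (⋃ s ∈ T \ {a}, B.region s T) :=
    disjoint_iUnion₂_right.2 fun s hs => B.disjoint_region ha hs.1 (Ne.symm hs.2)
  have hall := hpunct.subset_left_of_subset_union (B.isOpen_region a T)
    (isOpen_biUnion fun s _ => B.isOpen_region s T) hdisj hcover (hmeet a (by simp) ha)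
  obtain ⟨y, hy, hyb⟩ := hmeet b (by simp) hb
  exact disjoint_left.1 (B.disjoint_region ha hb hab) (hall hy) hyb

/-- A face of `V(S) ∩ D` that meets a face of the graph of the same site is contained in it. -/
lemma IsSite.voronoiFace_subset [Finite ι] (hD : IsOpen D) (hV : G.IsVoronoiLike)
    {g : Set Plane} (hg : G.IsFace g) {p : ι} (hp : G.IsSite g p) {f : Set Plane}
    (hf : B.IsVoronoiFace G.sites D p f) (h : (f ∩ g).Nonempty) : f ⊆ g := by
  refine hf.isPreconnected.subset_of_closure_inter_subset (hg.isOpen hD) h ?_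
  rintro x ⟨hxg, hxf⟩
  by_contra hx
  obtain ⟨hxR, hxD⟩ := hf.subset hxf
  obtain ⟨q, hq, hqp, hxq⟩ := hp.exists_mem_bisector hD hV hg hxg hxD hx
  exact disjoint_left.1 (B.disjoint_bisector_region hq hqp) hxq hxR

/-- A face of `V(S) ∩ D` of site `q` that meets a face of the graph of another site is missing
from the graph. -/
lemma isMissing_of_inter_nonempty [Finite ι] (hD : IsOpen D) (hV : G.IsVoronoiLike)
    {g : Set Plane} (hg : G.IsFace g) {p q : ι} (hp : G.IsSite g p) (hqp : q ≠ p) {f : Set Plane}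
    (hf : B.IsVoronoiFace G.sites D q f) (h : (f ∩ g).Nonempty) : G.IsMissing f := by
  refine ⟨q, hf, fun x hx => ?_⟩
  obtain ⟨g', hg', hxg'⟩ := exists_isFace_mem_closure hD hV (hf.subset hx).2
  refine mem_biUnion (show g' ∈ {g | G.IsFace g ∧ ¬ G.IsSite g q} from ⟨hg', fun hq => ?_⟩) hxg'
  have hsub := hq.voronoiFace_subset hD hV hg' hf (mem_closure_iff.1 hxg' f (hf.isOpen hD) hx)
  obtain rfl := hg'.eq_of_inter_nonempty hg (h.mono (inter_subset_inter_left _ hsub))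
  exact hqp (hp.2 q hq.1)

end ArrangementGraph

theorem theorem1 {ι : Type*} [Finite ι] (B : BisectorSystem ι) (hB : B.GeneralPosition)
    (D : Set Plane) (hD : IsOpen D) (hsc : SimplyConnectedSpace D)
    (G : ArrangementGraph B D) (hG : G.IsVoronoiLike)
    (r : Set Plane) (hr : G.IsFace r) (p : ι) (hp : G.IsSite r p) :
    (∃ r', B.IsVoronoiFace G.sites D p r' ∧ r' ⊆ B.region p G.sites ∧ r' ⊆ r) ∨
    (Disjoint r (B.region p G.sites) ∧
      r ⊆ ⋃ f ∈ {f | G.IsMissing f}, closure f) := by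
  have hpS : p ∈ G.sites := by
    obtain ⟨e, he, q, ha, -⟩ := hp.1
    exact ⟨e, he, q, ha⟩
  by_cases h : Disjoint r (B.region p G.sites)
  · refine Or.inr ⟨h, fun x hx => ?_⟩
    obtain ⟨q, f, hf, hxf⟩ :=
      B.exists_isVoronoiFace_mem_closure hB ⟨p, hpS⟩ hD (hr.subset hx).1
    have hfr : (f ∩ r).Nonempty := by
      rw [inter_comm]
      exact mem_closure_iff.1 hxf r (hr.isOpen hD) hx
    refine mem_biUnion (show f ∈ {f | G.IsMissing f} from ?_) hxf
    refine G.isMissing_of_inter_nonempty hD hG hr hp ?_ hf hfr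
    rintro rfl
    obtain ⟨y, hyf, hyr⟩ := hfr
    exact disjoint_left.1 h hyr (hf.subset hyf).1
  · obtain ⟨x, hxr, hxR⟩ := not_disjoint_iff.1 h
    have hx : x ∈ B.region p G.sites ∩ D := ⟨hxR, (hr.subset hxr).1⟩
    have hf : B.IsVoronoiFace G.sites D p (connectedComponentIn (B.region p G.sites ∩ D) x) :=
      ⟨hpS, x, hx, rfl⟩
    exact Or.inl ⟨_, hf, hf.subset.trans inter_subset_left,
      hp.voronoiFace_subset hD hG hr hf ⟨x, mem_connectedComponentIn hx, hxr⟩⟩
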